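/- Let $\mathbb D$ be the open unit disk and $\hat{\mathbb C}=\mathbb C\cup\{\infty\}$ the Riemann sphere. For a compact set $K\subset\mathbb C$, the analytic capacity of $K$ is $\gamma(K):=\sup_g|g'(\infty)|$, where the supremum is over all holomorphic $g:\hat{\mathbb C}\setminus K\to\mathbb D$ and $g'(\infty):=\lim_{z\to\infty}z(g(z)-g(\infty))$. A holomorphic motion of $\hat{\mathbb C}$ is a map $f:\mathbb D\times\hat{\mathbb C}\to\hat{\mathbb C}$, written $f_\lambda(z)=f(\lambda,z)$, such that $\lambda\mapsto f(\lambda,z)$ is holomorphic on $\mathbb D$ for each $z$, $f_\lambda$ is injective for each $\lambda$, and $f_0(z)=z$ for all $z$. Let $K\subset\mathbb C$ be compact with $\gamma(K)>0$. Let $f:\mathbb D\times\hat{\mathbb C}\to\hat{\mathbb C}$ be a holomorphic motion such that, for each $\lambda\in\mathbb D$, the map $f_\lambda$ is holomorphic on $\hat{\mathbb C}\setminus K$ and $f_\lambda(\infty)=\infty$. Write $K_\lambda:=f_\lambda(K)$, and let $M$ be a real number with $\gamma(K_\lambda)\le M$ for all $\lambda\in\mathbb D$. Then, for every $\lambda\in\mathbb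 D$, the set $K_\lambda$ is a compact subset of $\mathbb C$ with $\gamma(K_\lambda)>0$, and, if $\gamma(K)<M$, \[ \frac{1-|\lambda|}{1+|\lambda|}\le\frac{\log(M/\gamma(K_\lambda))}{\log(M/\gamma(K))}\le\frac{1+|\lambda|}{1-|\lambda|}, \] while, if $\gamma(K)=M$, then $\gamma(K_\lambda)=M$. -/

import Mathlib

open Filter Topology Bornology
open scoped Manifold ContDiff

/-- The Riemann sphere `ℂ ∪ {∞}`, with the topology of the one-point compactification. -/
abbrev RiemannSphere : Type := OnePoint ℂ

namespace RiemannSphere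

/-- The affine chart `z ↦ z` on `ℂ`. -/
noncomputable def chartFinite : OpenPartialHomeomorph RiemannSphere ℂ where
  toFun p := p.elim 0 id
  invFun z := (z : RiemannSphere)
  source := {OnePoint.infty}ᶜ
  target := Set.univ
  map_source' _ _ := Set.mem_univ _
  map_target' z _ := OnePoint.coe_ne_infty z
  left_inv' p hp := by
    induction p using OnePoint.rec with
    | infty => exact absurd rfl hp
    | coe z => rfl
  right_inv' _ _ := rfl
  open_source := isOpen_compl_singleton
  open_target := isOpen_univ
  continuousOn_toFun := by
    intro p hp
    induction p using OnePoint.rec with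
    | infty => exact absurd rfl hp
    | coe z =>
      refine ContinuousAt.continuousWithinAt ?_
      rw [OnePoint.continuousAt_coe]
      exact continuousAt_id
  continuousOn_invFun := OnePoint.continuous_coe.continuousOn

/-- The chart `z ↦ 1 / z` on `(ℂ ∖ {0}) ∪ {∞}`, sending `∞` to `0`. -/
noncomputable def chartInfty : OpenPartialHomeomorph RiemannSphere ℂ where
  toFun p := p.elim 0 (fun z => z⁻¹)
  invFun w := open Classical in if w = 0 then OnePoint.infty else ((w⁻¹ : ℂ) : RiemannSphere)
  source := {((0 : ℂ) : RiemannSphere)}ᶜ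
  target := Set.univ
  map_source' _ _ := Set.mem_univ _
  map_target' w _ := by
    by_cases hw : w = 0
    · simp [hw]
    · simp [hw]
  left_inv' p hp := by
    induction p using OnePoint.rec with
    | infty => simp
    | coe z =>
      have hz : z ≠ 0 := fun h => hp (by simp [h])
      simp [hz]
  right_inv' w _ := by
    by_cases hw : w = 0
    · simp [hw]
    · simp [hw]
  open_source := isOpen_compl_singleton
  open_target := isOpen_univ
  continuousOn_toFun := by
    intro p hp
    induction p using OnePoint.rec with
    | infty =>
      refine ContinuousAt.continuousWithinAt ?_
      rw [OnePoint.continuousAt_infty']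
      simpa [coclosedCompact_eq_cocompact, ← Metric.cobounded_eq_cocompact, Function.comp_def]
        using tendsto_inv₀_cobounded (α := ℂ)
    | coe z =>
      have hz : z ≠ 0 := fun h => hp (by simp [h])
      exact (OnePoint.continuousAt_coe.2 (continuousAt_inv₀ hz)).continuousWithinAt
  continuousOn_invFun := by
    refine Continuous.continuousOn (continuous_iff_continuousAt.2 fun w => ?_)
    by_cases hw : w = 0
    · subst hw
      rw [continuousAt_iff_punctured_nhds]
      have h : Tendsto (fun w : ℂ => ((w⁻¹ : ℂ) : RiemannSphere)) (𝓝[≠] 0)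
          (𝓝 OnePoint.infty) := by
        refine OnePoint.tendsto_coe_infty.comp ?_
        simpa [coclosedCompact_eq_cocompact, ← Metric.cobounded_eq_cocompact]
          using tendsto_inv₀_nhdsNE_zero (α := ℂ)
      simp only [if_true]
      refine h.congr' ?_
      filter_upwards [self_mem_nhdsWithin] with w hw
      exact (if_neg hw).symm
    · have h : ContinuousAt (fun w : ℂ => ((w⁻¹ : ℂ) : RiemannSphere)) w :=
        OnePoint.continuous_coe.continuousAt.comp (continuousAt_inv₀ hw)
      refine h.congr ?_
      filter_upwards [isOpen_ne.mem_nhds hw] with v hv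
      exact (if_neg hv).symm

/-- The two charts `z` and `1 / z` as an atlas of the Riemann sphere. -/
noncomputable instance : ChartedSpace ℂ RiemannSphere where
  atlas := {chartFinite, chartInfty}
  chartAt p := open Classical in if p = OnePoint.infty then chartInfty else chartFinite
  mem_chart_source p := by
    induction p using OnePoint.rec with
    | infty => simp [chartInfty]
    | coe z => simp [chartFinite]
  chart_mem_atlas p := by
    by_cases hp : p = OnePoint.infty
    · simp [hp]
    · simp [hp]

/-- The transition maps are analytic, so the Riemann sphere is a complex manifold. -/
instance : IsManifold 𝓘(ℂ) ω RiemannSphere := by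
  have key : ∀ s : Set ℂ, s ⊆ {0}ᶜ → ContDiffOn ℂ ω (fun z : ℂ => z⁻¹) s := fun s hs z hz =>
    (contDiffAt_inv ℂ (hs hz)).contDiffWithinAt
  refine isManifold_of_contDiffOn _ _ _ ?_
  intro e e' he he'
  simp only [modelWithCornersSelf_coe, modelWithCornersSelf_coe_symm,
    Set.preimage_id, Set.range_id, Set.inter_univ, CompTriple.comp_eq]
  rcases he with rfl | rfl <;> rcases he' with rfl | rfl
  · exact contDiffOn_id.congr fun z _ => rfl
  · refine (key _ ?_).congr fun z _ => rfl
    intro z hz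
    rintro rfl
    exact hz.2 rfl
  · have hs : (chartInfty.symm.trans chartFinite).source ⊆ {0}ᶜ := by
      intro z hz h0
      simp only [Set.mem_singleton_iff] at h0
      subst h0
      exact hz.2 (if_pos rfl)
    refine (key _ hs).congr fun z hz => ?_
    have hz0 : z ≠ 0 := hs hz
    change OnePoint.elim (open Classical in
      if z = 0 then OnePoint.infty else ((z⁻¹ : ℂ) : RiemannSphere)) 0 id = z⁻¹
    simp [hz0]
  · refine contDiffOn_id.congr fun z _ => ?_
    exact chartInfty.right_inv (Set.mem_univ z)

end RiemannSphere

/-- A holomorphic motion `f : 𝔻 × A → ℂ ∪ {∞}` of a subset `A` of the Riemann sphere, written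
`f lam z`; only the values for `lam` in the open unit disk and `z ∈ A` matter. -/
structure IsHolomorphicMotion (A : Set RiemannSphere)
    (f : ℂ → RiemannSphere → RiemannSphere) : Prop where
  holomorphic : ∀ z ∈ A, MDifferentiableOn 𝓘(ℂ) 𝓘(ℂ) (fun lam => f lam z) (Metric.ball 0 1)
  injOn : ∀ lam ∈ Metric.ball (0 : ℂ) 1, Set.InjOn (f lam) A
  map_zero : ∀ z ∈ A, f 0 z = z

/-- The complement `(ℂ ∪ {∞}) ∖ K` of a set `K ⊆ ℂ` in the Riemann sphere. -/
def sphereCompl (K : Set ℂ) : Set RiemannSphere :=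
  ((fun z : ℂ => (z : RiemannSphere)) '' K)ᶜ

/-- The analytic capacity `γ(K) = sup |g'(∞)|` of a compact set `K ⊆ ℂ`, the supremum being over
the holomorphic `g : (ℂ ∪ {∞}) ∖ K → 𝔻`, where `g'(∞) = lim_{z → ∞} z (g z - g ∞)`. -/
noncomputable def analyticCapacity (K : Set ℂ) : ℝ :=
  sSup {r : ℝ | ∃ (g : RiemannSphere → ℂ) (d : ℂ),
    MDifferentiableOn 𝓘(ℂ) 𝓘(ℂ) g (sphereCompl K) ∧
    (∀ p ∈ sphereCompl K, ‖g p‖ < 1) ∧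
    Tendsto (fun z : ℂ => z * (g (z : RiemannSphere) - g OnePoint.infty)) (cobounded ℂ) (𝓝 d) ∧
    r = ‖d‖}

/-- The set `K_λ = f_λ(K)`, as a set of complex numbers; nothing is lost by this when
`∞ ∉ f_λ(K)`. -/
def movedSet (f : ℂ → RiemannSphere → RiemannSphere) (K : Set ℂ) (lam : ℂ) : Set ℂ :=
  {w : ℂ | ∃ z ∈ K, f lam (z : RiemannSphere) = (w : RiemannSphere)}

/-!
Each `f_λ` is conformal near `∞`, with a derivative `a(λ) = lim f_λ(z) / z` there, and pulling back
competitors gives `γ(K_λ) = |a(λ)| γ(K)` as soon as `f_λ` is a homeomorphism. The function `a` is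
holomorphic and has no zeros, so `log (M / γ(K_λ))` is a nonnegative harmonic function of `λ`, and
the theorem is Harnack's inequality for it.

By the Koebe theorem in the coordinate `1 / z`, the convergence `f_λ(z) / z → a(λ)` is locally
uniform in `λ`, which makes `a` holomorphic, and `(f_λ(w) - f_λ(z)) / a(λ)` is bounded uniformly in
`λ`. This quotient has no zeros for `w ≠ z`, so Harnack's inequality bounds it by a positive power
of its value `w - z` at `λ = 0`, and `f_λ` is continuous. A continuous map `g` of the plane with
`g(z) / z → a ≠ 0` is onto, because otherwise `z` would have a continuous logarithm on large
circles.
-/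

section InjectiveHolomorphic

variable {f : ℂ → ℂ} {U : Set ℂ} {z : ℂ}

theorem map_nhds_eq_of_analyticAt_of_injOn (hf : AnalyticAt ℂ f z) (hU : U ∈ 𝓝 z)
    (hinj : Set.InjOn f U) : map f (𝓝 z) = 𝓝 (f z) := by
  refine le_antisymm hf.continuousAt
    (hf.eventually_constant_or_nhds_le_map_nhds.resolve_left fun hconst => ?_)
  obtain ⟨w, ⟨hwf, hwU⟩, hwz⟩ := Eventually.exists <|
    ((hconst.and hU).filter_mono nhdsWithin_le_nhds).and (eventually_mem_nhdsWithin (s := {z}ᶜ))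
  exact hwz (hinj hwU (mem_of_mem_nhds hU) hwf)

theorem map_nhds_eq_of_injOn (hf : DifferentiableOn ℂ f U) (hU : IsOpen U)
    (hinj : Set.InjOn f U) (hz : z ∈ U) : map f (𝓝 z) = 𝓝 (f z) :=
  map_nhds_eq_of_analyticAt_of_injOn (hf.analyticAt (hU.mem_nhds hz)) (hU.mem_nhds hz) hinj

theorem isOpen_image_of_injOn (hf : DifferentiableOn ℂ f U) (hU : IsOpen U)
    (hinj : Set.InjOn f U) : IsOpen (f '' U) := by
  rw [isOpen_iff_mem_nhds]
  rintro _ ⟨z, hz, rfl⟩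
  rw [← map_nhds_eq_of_injOn hf hU hinj hz]
  exact image_mem_map (hU.mem_nhds hz)

theorem continuousAt_of_leftInvOn {g : ℂ → ℂ} (hf : DifferentiableOn ℂ f U) (hU : IsOpen U)
    (hgf : Set.LeftInvOn g f U) (hz : z ∈ U) : ContinuousAt g (f z) := by
  rw [ContinuousAt, hgf hz, ← map_nhds_eq_of_injOn hf hU hgf.injOn hz, tendsto_map'_iff]
  exact tendsto_id.congr' ((hgf.eqOn.eventuallyEq_of_mem (hU.mem_nhds hz)).symm)

theorem eventually_deriv_ne_zero_of_injOn (hf : DifferentiableOn ℂ f U) (hU : IsOpen U)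
    (hinj : Set.InjOn f U) (hz : z ∈ U) : ∀ᶠ w in 𝓝[≠] z, deriv f w ≠ 0 := by
  refine (hf.analyticAt (hU.mem_nhds hz)).deriv.eventually_eq_zero_or_eventually_ne_zero
    |>.resolve_left fun hzero => ?_
  obtain ⟨r, hr, hball⟩ := Metric.eventually_nhds_iff_ball.1 (hzero.and (hU.mem_nhds hz))
  obtain ⟨w, hwz, hw⟩ := ((eventually_mem_nhdsWithin (s := {z}ᶜ)).and
    (mem_nhdsWithin_of_mem_nhds (Metric.ball_mem_nhds z hr))).exists
  have hconst := Metric.isOpen_ball.is_const_of_deriv_eq_zero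
    (convex_ball z r).isPreconnected (hf.mono fun v hv => (hball v hv).2)
    (fun v hv => (hball v hv).1) hw (Metric.mem_ball_self hr)
  exact hwz (hinj (hball w hw).2 hz hconst)

theorem differentiableAt_of_leftInvOn {g : ℂ → ℂ} (hf : DifferentiableOn ℂ f U) (hU : IsOpen U)
    (hgf : Set.LeftInvOn g f U) (hz : z ∈ U) : DifferentiableAt ℂ g (f z) := by
  -- The zeros of `deriv f` are isolated, hence so are the possible singularities of `g`.
  refine (Complex.analyticAt_of_differentiable_on_punctured_nhds_of_continuousAt ?_
    (continuousAt_of_leftInvOn hf hU hgf hz)).differentiableAt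
  have hright : ∀ w ∈ U, ∀ᶠ y in 𝓝 (f w), f (g y) = y := fun w hw => by
    rw [← map_nhds_eq_of_injOn hf hU hgf.injOn hw, eventually_map]
    filter_upwards [hU.mem_nhds hw] with v hv using by rw [hgf hv]
  have hregular : ∀ᶠ w in 𝓝 z, w ∈ U ∧ (w ≠ z → deriv f w ≠ 0) :=
    (hU.eventually_mem hz).and (eventually_nhdsWithin_iff.1
      (eventually_deriv_ne_zero_of_injOn hf hU hgf.injOn hz))
  rw [eventually_nhdsWithin_iff, ← map_nhds_eq_of_injOn hf hU hgf.injOn hz, eventually_map]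
  filter_upwards [hregular] with w ⟨hw, hderiv⟩ hne
  have hfw : HasDerivAt f (deriv f w) (g (f w)) := by
    simpa only [hgf hw] using (hf.differentiableAt (hU.mem_nhds hw)).hasDerivAt
  exact (HasDerivAt.of_local_left_inverse (continuousAt_of_leftInvOn hf hU hgf hw) hfw
    (hderiv fun h => hne (h ▸ rfl)) (hright w hw)).differentiableAt

theorem deriv_ne_zero_of_injOn (hf : DifferentiableOn ℂ f U) (hU : IsOpen U)
    (hinj : Set.InjOn f U) (hz : z ∈ U) : deriv f z ≠ 0 := by
  have hgf := hinj.leftInvOn_invFunOn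
  have hinv := (differentiableAt_of_leftInvOn hf hU hgf hz).hasDerivAt.comp z
    (hf.differentiableAt (hU.mem_nhds hz)).hasDerivAt
  have hone := hinv.unique
    ((hasDerivAt_id z).congr_of_eventuallyEq (hgf.eqOn.eventuallyEq_of_mem (hU.mem_nhds hz)))
  exact right_ne_zero_of_mul_eq_one hone

end InjectiveHolomorphic

section Branches

variable {f g h : ℂ → ℂ} {U : Set ℂ}

theorem differentiableAt_of_comp {z h' : ℂ} (hcont : ContinuousAt f z)
    (hh : HasStrictDerivAt h h' (f z)) (hh' : h' ≠ 0) (hcomp : DifferentiableAt ℂ (h ∘ f) z) :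
    DifferentiableAt ℂ f z := by
  have hinv := (hh.to_localInverse hh').hasDerivAt.differentiableAt.comp z hcomp
  refine hinv.congr_of_eventuallyEq ?_
  filter_upwards [hcont.eventually (hh.hasStrictFDerivAt_equiv hh').eventually_left_inverse]
    with w hw using hw.symm

theorem exists_differentiableOn_exp_eq (hU : IsOpen U) (hsimply : IsSimplyConnected U)
    (hg : DifferentiableOn ℂ g U) (hg0 : ∀ z ∈ U, g z ≠ 0) :
    ∃ L : ℂ → ℂ, DifferentiableOn ℂ L U ∧ ∀ z ∈ U, Complex.exp (L z) = g z := by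
  obtain ⟨L, hLcont, hL⟩ := Complex.exists_continuousOn_eqOn_exp_comp hsimply hU hg.continuousOn
    fun ⟨z, hz, h⟩ => hg0 z hz h
  refine ⟨L, fun z hz => DifferentiableAt.differentiableWithinAt ?_, hL⟩
  exact differentiableAt_of_comp (hLcont.continuousAt (hU.mem_nhds hz))
    (Complex.hasStrictDerivAt_exp (L z)) (Complex.exp_ne_zero _)
    ((hg.differentiableAt (hU.mem_nhds hz)).congr_of_eventuallyEq
      (hL.eventuallyEq_of_mem (hU.mem_nhds hz)))

theorem exists_differentiableOn_sq_eq (hU : IsOpen U) (hsimply : IsSimplyConnected U)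
    (hg : DifferentiableOn ℂ g U) (hg0 : ∀ z ∈ U, g z ≠ 0) :
    ∃ k : ℂ → ℂ, DifferentiableOn ℂ k U ∧ ∀ z ∈ U, k z ^ 2 = g z := by
  obtain ⟨L, hLdiff, hL⟩ := exists_differentiableOn_exp_eq hU hsimply hg hg0
  refine ⟨fun z => Complex.exp (L z / 2), (hLdiff.div_const 2).cexp, fun z hz => ?_⟩
  rw [← Complex.exp_nat_mul, Nat.cast_ofNat, mul_div_cancel₀ _ two_ne_zero, hL z hz]

theorem isSimplyConnected_of_convex {E : Type*} [AddCommGroup E] [Module ℝ E] [TopologicalSpace E]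
    [ContinuousAdd E] [ContinuousSMul ℝ E] {s : Set E} (hs : Convex ℝ s) (hne : s.Nonempty) :
    IsSimplyConnected s := by
  have := hs.contractibleSpace hne
  exact inferInstanceAs (SimplyConnectedSpace s)

end Branches

section Harnack

theorem abs_re_sub_le_of_norm_sub_le {p a : ℂ} {t : ℝ} (ht0 : 0 ≤ t) (ht1 : t ≤ 1)
    (hpa : 0 ≤ p.re + a.re) (h : ‖p - a‖ ≤ t * ‖p + (starRingEnd ℂ) a‖) :
    |p.re - a.re| ≤ t * (p.re + a.re) := by
  have hsq : ‖p - a‖ ^ 2 ≤ (t * ‖p + (starRingEnd ℂ) a‖) ^ 2 := by gcongr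
  rw [mul_pow, Complex.sq_norm, Complex.sq_norm, Complex.normSq_apply, Complex.normSq_apply] at hsq
  simp only [Complex.sub_re, Complex.sub_im, Complex.add_re, Complex.add_im, Complex.conj_re,
    Complex.conj_im] at hsq
  have him : t ^ 2 * (p.im - a.im) ^ 2 ≤ (p.im - a.im) ^ 2 :=
    mul_le_of_le_one_left (sq_nonneg _) (pow_le_one₀ ht0 ht1)
  refine abs_le_of_sq_le_sq ?_ (by positivity)
  linarith

variable {P : ℂ → ℂ} {c z : ℂ} {R : ℝ}

/-- The Schwarz lemma for `(P - P c) / (P + conj (P c))`, the Cayley transform of `P`. -/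
theorem harnack_of_re_pos (hP : DifferentiableOn ℂ P (Metric.ball c R))
    (hpos : ∀ w ∈ Metric.ball c R, 0 < (P w).re) (hz : z ∈ Metric.ball c R) :
    |(P z).re - (P c).re| ≤ dist z c / R * ((P z).re + (P c).re) := by
  have hR : 0 < R := dist_nonneg.trans_lt hz
  have hPc := hpos c (Metric.mem_ball_self hR)
  have hne : ∀ w ∈ Metric.ball c R, P w + (starRingEnd ℂ) (P c) ≠ 0 := fun w hw h => by
    have hre := congrArg Complex.re h
    simp only [Complex.add_re, Complex.conj_re, Complex.zero_re] at hre
    linarith [hpos w hw]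
  have hdiff : DifferentiableOn ℂ (fun w => (P w - P c) / (P w + (starRingEnd ℂ) (P c)))
      (Metric.ball c R) := (hP.sub_const _).div (hP.add_const _) hne
  have hmaps : Set.MapsTo (fun w => (P w - P c) / (P w + (starRingEnd ℂ) (P c)))
      (Metric.ball c R) (Metric.closedBall ((P c - P c) / (P c + (starRingEnd ℂ) (P c))) 1) := by
    intro w hw
    rw [sub_self, zero_div, mem_closedBall_zero_iff, norm_div,
      div_le_one₀ (by simpa using hne w hw)]
    refine le_of_sq_le_sq ?_ (norm_nonneg _)
    simp only [Complex.sq_norm, Complex.normSq_apply, Complex.sub_re, Complex.sub_im,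
      Complex.add_re, Complex.add_im, Complex.conj_re, Complex.conj_im]
    linarith [mul_pos (hpos w hw) hPc]
  have hschwarz := Complex.dist_le_div_mul_dist_of_mapsTo_ball hdiff hmaps hz
  rw [sub_self, zero_div, dist_zero_right, norm_div, div_le_iff₀ (by simpa using hne z hz),
    one_div_mul_eq_div] at hschwarz
  exact abs_re_sub_le_of_norm_sub_le (by positivity) ((div_le_one hR).2 hz.le)
    (add_pos (hpos z hz) hPc).le hschwarz

theorem harnack_of_re_nonneg (hP : DifferentiableOn ℂ P (Metric.ball c R))
    (hnonneg : ∀ w ∈ Metric.ball c R, 0 ≤ (P w).re) (hz : z ∈ Metric.ball c R) :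
    |(P z).re - (P c).re| ≤ dist z c / R * ((P z).re + (P c).re) := by
  have hR : 0 < R := dist_nonneg.trans_lt hz
  refine le_of_forall_pos_le_add fun ε hε => ?_
  have hshift := harnack_of_re_pos (P := fun w => P w + (ε / 2 : ℝ)) (hP.add_const _)
    (fun w hw => by
      rw [Complex.add_re, Complex.ofReal_re]
      linarith [hnonneg w hw]) hz
  simp only [Complex.add_re, Complex.ofReal_re, add_sub_add_right_eq_sub] at hshift
  have hle : dist z c / R * ε ≤ ε := mul_le_of_le_one_left hε.le ((div_le_one hR).2 hz.le)
  linarith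

variable {φ : ℂ → ℂ} {B : ℝ}

/-- `log (B / ‖φ‖)` is the real part of `log B - log φ`, a holomorphic function. -/
theorem harnack_log_div_norm (hφ : DifferentiableOn ℂ φ (Metric.ball c R))
    (hφ0 : ∀ w ∈ Metric.ball c R, φ w ≠ 0) (hB : ∀ w ∈ Metric.ball c R, ‖φ w‖ ≤ B)
    (hz : z ∈ Metric.ball c R) :
    |Real.log (B / ‖φ z‖) - Real.log (B / ‖φ c‖)| ≤
      dist z c / R * (Real.log (B / ‖φ z‖) + Real.log (B / ‖φ c‖)) := by
  have hR : 0 < R := dist_nonneg.trans_lt hz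
  have hc := Metric.mem_ball_self (x := c) hR
  obtain ⟨L, hLdiff, hL⟩ :=
    exists_differentiableOn_exp_eq Metric.isOpen_ball
      (isSimplyConnected_of_convex (convex_ball c R) ⟨c, hc⟩) hφ hφ0
  have hBpos : 0 < B := (norm_pos_iff.2 (hφ0 c hc)).trans_le (hB c hc)
  have hre : ∀ w ∈ Metric.ball c R, (Real.log B - L w : ℂ).re = Real.log (B / ‖φ w‖) :=
    fun w hw => by
      rw [Real.log_div hBpos.ne' (norm_ne_zero_iff.2 (hφ0 w hw)), ← hL w hw, Complex.norm_exp,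
        Real.log_exp, Complex.sub_re, Complex.ofReal_re]
  have hnonneg : ∀ w ∈ Metric.ball c R, 0 ≤ (Real.log B - L w : ℂ).re := fun w hw => by
    rw [hre w hw]
    exact Real.log_nonneg ((one_le_div (norm_pos_iff.2 (hφ0 w hw))).2 (hB w hw))
  simpa only [hre z hz, hre c hc] using harnack_of_re_nonneg (hLdiff.const_sub _) hnonneg hz

theorem norm_le_mul_rpow_of_norm_le (hφ : DifferentiableOn ℂ φ (Metric.ball 0 1))
    (hφ0 : ∀ w ∈ Metric.ball (0 : ℂ) 1, φ w ≠ 0) (hB : ∀ w ∈ Metric.ball (0 : ℂ) 1, ‖φ w‖ ≤ B)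
    (hz : z ∈ Metric.ball (0 : ℂ) 1) :
    ‖φ z‖ ≤ B * (‖φ 0‖ / B) ^ ((1 - ‖z‖) / (1 + ‖z‖)) := by
  have hφc : 0 < ‖φ 0‖ := norm_pos_iff.2 (hφ0 0 (Metric.mem_ball_self one_pos))
  have hφz : 0 < ‖φ z‖ := norm_pos_iff.2 (hφ0 z hz)
  have hBpos : 0 < B := hφz.trans_le (hB z hz)
  have hharnack := (abs_le.1 (harnack_log_div_norm hφ hφ0 hB hz)).1
  rw [dist_zero_right, div_one] at hharnack
  have hlog : (1 - ‖z‖) / (1 + ‖z‖) * Real.log (B / ‖φ 0‖) ≤ Real.log (B / ‖φ z‖) := by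
    rw [div_mul_eq_mul_div, div_le_iff₀ (by positivity)]
    linarith
  rw [← Real.log_le_log_iff hφz (by positivity), Real.log_mul hBpos.ne' (by positivity),
    Real.log_rpow (by positivity), ← inv_div B, Real.log_inv]
  rw [Real.log_div hBpos.ne' hφz.ne'] at hlog
  linarith

end Harnack

section Koebe

variable {f : ℂ → ℂ} {c : ℂ} {r : ℝ}

theorem two_fifths_le_norm_add_one {k : ℂ} (hre : 0 < k.re ∨ 1 ≤ ‖1 - k ^ 2‖) :
    2 / 5 ≤ ‖k + 1‖ := by
  rcases hre with hre | hlarge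
  · have := Complex.re_le_norm (k + 1)
    rw [Complex.add_re, Complex.one_re] at this
    linarith
  · by_contra! hsmall
    have hfactor : ‖1 - k ^ 2‖ = ‖k + 1‖ * ‖2 - (k + 1)‖ := by rw [← norm_mul]; ring_nf
    have htwo : ‖(2 : ℂ) - (k + 1)‖ ≤ 2 + ‖k + 1‖ := by simpa using norm_sub_le (2 : ℂ) (k + 1)
    nlinarith [norm_nonneg (k + 1)]

theorem re_pos_of_re_sq_pos {k : ℂ → ℂ} {V : Set ℂ} (hV : IsPreconnected V)
    (hk : ContinuousOn k V) (hsq : ∀ z ∈ V, 0 < (k z ^ 2).re) (hc : c ∈ V) (hkc : 0 < (k c).re)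
    {z : ℂ} (hz : z ∈ V) : 0 < (k z).re := by
  by_contra! hneg
  obtain ⟨w, hw, hre⟩ := hV.intermediate_value hz hc (Complex.continuous_re.comp_continuousOn hk)
    ⟨hneg, hkc.le⟩
  have hpos := hsq w hw
  rw [pow_two, Complex.mul_re, show (k w).re = 0 from hre] at hpos
  nlinarith [mul_self_nonneg (k w).im]

theorem isPreconnected_inter_preimage_of_injOn {U s : Set ℂ} (hf : DifferentiableOn ℂ f U)
    (hU : IsOpen U) (hinj : Set.InjOn f U) (hs : IsPreconnected s) (hsub : s ⊆ f '' U) :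
    IsPreconnected (U ∩ f ⁻¹' s) := by
  have hgf := hinj.leftInvOn_invFunOn
  have himage : Function.invFunOn f U '' s = U ∩ f ⁻¹' s := by
    ext z
    constructor
    · rintro ⟨y, hy, rfl⟩
      obtain ⟨w, hw, rfl⟩ := hsub hy
      rw [hgf hw]
      exact ⟨hw, hy⟩
    · rintro ⟨hz, hfz⟩
      exact ⟨f z, hfz, hgf hz⟩
  rw [← himage]
  refine hs.image _ fun y hy => ?_
  obtain ⟨w, hw, rfl⟩ := hsub hy
  exact (continuousAt_of_leftInvOn hf hU hgf hw).continuousWithinAt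

/-- The real part of `k` is positive where `‖f - f c‖ < ‖δ‖`, since `k ^ 2` lies in the right
half-plane there; elsewhere `‖1 - k ^ 2‖ ≥ 1`. -/
theorem exists_sq_eq_one_sub_div (hf : DifferentiableOn ℂ f (Metric.ball c r))
    (hinj : Set.InjOn f (Metric.ball c r)) (hr : 0 < r) {δ : ℂ} (hδ0 : δ ≠ 0)
    (hsub : Metric.ball (f c) ‖δ‖ ⊆ f '' Metric.ball c r) (hδ : f c + δ ∉ f '' Metric.ball c r) :
    ∃ k : ℂ → ℂ, DifferentiableOn ℂ k (Metric.ball c r) ∧ k c = 1 ∧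
      (∀ z ∈ Metric.ball c r, k z ^ 2 = 1 - (f z - f c) / δ) ∧
      ∀ z ∈ Metric.ball c r, 2 / 5 ≤ ‖k z + 1‖ := by
  have hc := Metric.mem_ball_self (x := c) hr
  obtain ⟨k, hkdiff, hkc, hksq⟩ : ∃ k : ℂ → ℂ, DifferentiableOn ℂ k (Metric.ball c r) ∧ k c = 1 ∧
      ∀ z ∈ Metric.ball c r, k z ^ 2 = 1 - (f z - f c) / δ := by
    obtain ⟨k, hkdiff, hksq⟩ := exists_differentiableOn_sq_eq Metric.isOpen_ball
      (isSimplyConnected_of_convex (convex_ball c r) ⟨c, hc⟩)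
      (((hf.sub_const (f c)).div_const δ).const_sub 1)
      fun z hz h => hδ ⟨z, hz, by field_simp at h; linear_combination -h⟩
    have hkc : k c ^ 2 = 1 := by rw [hksq c hc, sub_self, zero_div, sub_zero]
    rcases sq_eq_sq_iff_eq_or_eq_neg.1 (hkc.trans (one_pow 2).symm) with hkc | hkc
    · exact ⟨k, hkdiff, hkc, hksq⟩
    · exact ⟨-k, hkdiff.neg, by simp [hkc], fun z hz => by rw [Pi.neg_apply, neg_sq, hksq z hz]⟩
  refine ⟨k, hkdiff, hkc, hksq, fun z hz => two_fifths_le_norm_add_one ?_⟩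
  rw [hksq z hz, sub_sub_cancel, norm_div, one_le_div (norm_pos_iff.2 hδ0), or_iff_not_imp_right,
    not_le, ← dist_eq_norm]
  intro hz'
  have hsqpos : ∀ w ∈ Metric.ball c r ∩ f ⁻¹' Metric.ball (f c) ‖δ‖, 0 < (k w ^ 2).re := by
    rintro w ⟨hw, hfw⟩
    have hlt : ‖(f w - f c) / δ‖ < 1 := by
      rwa [norm_div, div_lt_one (norm_pos_iff.2 hδ0), ← dist_eq_norm]
    rw [hksq w hw, Complex.sub_re, Complex.one_re]
    linarith [Complex.re_le_norm ((f w - f c) / δ)]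
  exact re_pos_of_re_sq_pos (isPreconnected_inter_preimage_of_injOn hf Metric.isOpen_ball hinj
    (convex_ball (f c) ‖δ‖).isPreconnected hsub) (hkdiff.continuousOn.mono Set.inter_subset_left)
    hsqpos ⟨hc, Metric.mem_ball_self (norm_pos_iff.2 hδ0)⟩ (by simp [hkc]) ⟨hz, hz'⟩

theorem norm_deriv_mul_le_of_ball_subset_image (hf : DifferentiableOn ℂ f (Metric.ball c r))
    (hinj : Set.InjOn f (Metric.ball c r)) (hr : 0 < r) {δ : ℂ} (hδ0 : δ ≠ 0)
    (hsub : Metric.ball (f c) ‖δ‖ ⊆ f '' Metric.ball c r) (hδ : f c + δ ∉ f '' Metric.ball c r) :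
    ‖deriv f c‖ * r ≤ 24 * ‖δ‖ := by
  have hnhds := Metric.ball_mem_nhds c hr
  obtain ⟨k, hkdiff, hkc, hksq, hk⟩ := exists_sq_eq_one_sub_div hf hinj hr hδ0 hsub hδ
  have hk0 : ∀ z ∈ Metric.ball c r, k z + 1 ≠ 0 := fun z hz =>
    norm_pos_iff.1 (lt_of_lt_of_le (by norm_num) (hk z hz))
  have hkderiv : deriv k c = -(deriv f c / δ) / 2 := by
    have hsq := ((hkdiff.differentiableAt hnhds).hasDerivAt.fun_pow 2).unique
      (((((hf.differentiableAt hnhds).hasDerivAt.sub_const (f c)).div_const δ).const_sub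
        1).congr_of_eventuallyEq (eventually_of_mem hnhds hksq))
    rw [hkc] at hsq
    linear_combination hsq / 2
  have hinvderiv : deriv (fun z => (k z + 1)⁻¹) c = deriv f c / (8 * δ) := by
    have hinv := ((hkdiff.differentiableAt hnhds).hasDerivAt.add_const 1).fun_inv
      (hk0 c (Metric.mem_ball_self hr))
    rw [hinv.deriv, hkderiv, hkc]
    field_simp
    ring
  have hmaps : Set.MapsTo (fun z => (k z + 1)⁻¹) (Metric.ball c r)
      (Metric.closedBall (k c + 1)⁻¹ 3) := fun z hz => by
    have hbound : ‖(k z + 1)⁻¹‖ ≤ 5 / 2 := by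
      rw [norm_inv, ← inv_div]
      exact inv_anti₀ (by norm_num) (hk z hz)
    have hcentre : ‖(k c + 1)⁻¹‖ = 1 / 2 := by rw [hkc]; norm_num
    rw [mem_closedBall_iff_norm]
    linarith [norm_sub_le (k z + 1)⁻¹ (k c + 1)⁻¹]
  have hcauchy := Complex.norm_deriv_le_div_of_mapsTo_ball
    ((hkdiff.add_const 1).fun_inv hk0) hmaps hr
  rw [hinvderiv, norm_div, norm_mul, Complex.norm_ofNat,
    div_le_div_iff₀ (mul_pos (by norm_num) (norm_pos_iff.2 hδ0)) hr] at hcauchy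
  linarith

/-- A weak form of the Koebe quarter theorem: if `f c + δ` is an omitted value nearest to `f c` and
`k ^ 2 = 1 - (f - f c) / δ`, then Cauchy's estimate for `1 / (k + 1)` bounds `deriv f c`. -/
theorem ball_subset_image_of_injOn (hf : DifferentiableOn ℂ f (Metric.ball c r))
    (hinj : Set.InjOn f (Metric.ball c r)) :
    Metric.ball (f c) (‖deriv f c‖ * r / 24) ⊆ f '' Metric.ball c r := by
  rcases le_or_gt r 0 with hr | hr
  · rw [Metric.ball_eq_empty.2 (by nlinarith [norm_nonneg (deriv f c)])]
    exact Set.empty_subset _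
  intro w hw
  by_contra hwf
  have hopen := isOpen_image_of_injOn hf Metric.isOpen_ball hinj
  obtain ⟨v, hv, hdist⟩ :=
    hopen.isClosed_compl.exists_infDist_eq_dist ⟨w, hwf⟩ (f c)
  have hsub : Metric.ball (f c) ‖v - f c‖ ⊆ f '' Metric.ball c r := by
    rw [← dist_eq_norm, dist_comm, ← hdist]
    simpa using Metric.ball_infDist_compl_subset (s := f '' Metric.ball c r) (x := f c)
  have hv0 : v - f c ≠ 0 := fun h =>
    hv (sub_eq_zero.1 h ▸ Set.mem_image_of_mem f (Metric.mem_ball_self hr))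
  have hle := norm_deriv_mul_le_of_ball_subset_image hf hinj hr hv0 hsub (by simpa using hv)
  have hvw : ‖v - f c‖ ≤ dist w (f c) := by
    rw [← dist_eq_norm, dist_comm, ← hdist, dist_comm w]
    exact Metric.infDist_le_dist_of_mem hwf
  linarith [Metric.mem_ball.1 hw]

end Koebe

/-- The map `ζ ↦ 1 / (g (1 / ζ) - g 0)`, which describes `g - g 0` near `∞` in the coordinate
`1 / z`. With the convention `0⁻¹ = 0` it is injective on all of `ℂ` and fixes `0` whenever `g` is
injective. -/
noncomputable def inversionConj (g : ℂ → ℂ) (ζ : ℂ) : ℂ := (g ζ⁻¹ - g 0)⁻¹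

/-- The leading coefficient `a` of `g z = a z + O(1)` at `∞`, encoded as the inverse of the
derivative at `0` of `inversionConj g`. -/
noncomputable def derivInfty (g : ℂ → ℂ) : ℂ := (deriv (inversionConj g) 0)⁻¹

/-- An injective, not necessarily continuous, self-map of `ℂ` that is holomorphic on `‖z‖ > R` and
fixes `∞`. -/
structure ConformalOutside (R : ℝ) (g : ℂ → ℂ) : Prop where
  radius_pos : 0 < R
  injective : Function.Injective g
  differentiableOn : DifferentiableOn ℂ g (Metric.closedBall 0 R)ᶜ
  tendsto_cobounded : Tendsto g (cobounded ℂ) (cobounded ℂ)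

section Inversion

variable {g : ℂ → ℂ}

theorem inversionConj_zero : inversionConj g 0 = 0 := by simp [inversionConj]

theorem inversionConj_inv (z : ℂ) : (inversionConj g z⁻¹)⁻¹ = g z - g 0 := by simp [inversionConj]

theorem inversionConj_injective (hg : Function.Injective g) :
    Function.Injective (inversionConj g) :=
  inv_injective.comp (sub_left_injective.comp (hg.comp inv_injective))

theorem inv_dslope_inversionConj (g : ℂ → ℂ) {ζ : ℂ} (hζ : ζ ≠ 0) :
    (dslope (inversionConj g) 0 ζ)⁻¹ = ζ * (g ζ⁻¹ - g 0) := by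
  rw [dslope_of_ne _ hζ, slope_def_field, inversionConj_zero, sub_zero, sub_zero, inv_div,
    inversionConj, div_inv_eq_mul]

theorem derivInfty_id : derivInfty id = 1 := by
  have hid : inversionConj id = id := by ext ζ; simp [inversionConj]
  rw [derivInfty, hid, deriv_id, inv_one]

end Inversion

namespace ConformalOutside

variable {g : ℂ → ℂ} {R S : ℝ}

theorem mono (hg : ConformalOutside R g) (hRS : R ≤ S) : ConformalOutside S g where
  radius_pos := hg.radius_pos.trans_le hRS
  injective := hg.injective
  differentiableOn := hg.differentiableOn.mono
    (Set.compl_subset_compl.2 (Metric.closedBall_subset_closedBall hRS))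
  tendsto_cobounded := hg.tendsto_cobounded

theorem differentiableOn_inversionConj (hg : ConformalOutside R g) :
    DifferentiableOn ℂ (inversionConj g) (Metric.ball 0 R⁻¹) := by
  refine (Complex.differentiableOn_compl_singleton_and_continuousAt_iff
    (Metric.ball_mem_nhds 0 (inv_pos.2 hg.radius_pos))).1 ⟨?_, ?_⟩
  · rintro ζ ⟨hζ, hζ0 : ζ ≠ 0⟩
    have hmem : ζ⁻¹ ∈ (Metric.closedBall (0 : ℂ) R)ᶜ := by
      rw [mem_ball_zero_iff] at hζ
      simpa using (lt_inv_comm₀ (norm_pos_iff.2 hζ0) hg.radius_pos).1 hζ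
    have hdiff := (hg.differentiableOn.differentiableAt
      (Metric.isClosed_closedBall.isOpen_compl.mem_nhds hmem)).comp ζ (differentiableAt_inv hζ0)
    exact ((hdiff.sub_const (g 0)).inv (sub_ne_zero.2 (hg.injective.ne
      (inv_ne_zero hζ0)))).differentiableWithinAt
  · rw [continuousAt_iff_punctured_nhds, inversionConj_zero]
    exact tendsto_inv₀_cobounded.comp ((tendsto_sub_const_cobounded (g 0)).comp
      (hg.tendsto_cobounded.comp tendsto_inv₀_nhdsNE_zero))

theorem deriv_inversionConj_ne_zero (hg : ConformalOutside R g) :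
    deriv (inversionConj g) 0 ≠ 0 :=
  deriv_ne_zero_of_injOn hg.differentiableOn_inversionConj Metric.isOpen_ball
    (inversionConj_injective hg.injective).injOn (Metric.mem_ball_self (inv_pos.2 hg.radius_pos))

theorem derivInfty_ne_zero (hg : ConformalOutside R g) : derivInfty g ≠ 0 :=
  inv_ne_zero hg.deriv_inversionConj_ne_zero

theorem tendsto_div (hg : ConformalOutside R g) :
    Tendsto (fun z => g z / z) (cobounded ℂ) (𝓝 (derivInfty g)) := by
  have hderiv := hasDerivAt_iff_tendsto_slope_zero.1
    (hg.differentiableOn_inversionConj.differentiableAt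
      (Metric.ball_mem_nhds 0 (inv_pos.2 hg.radius_pos))).hasDerivAt
  have hslope := ((hderiv.comp tendsto_inv₀_cobounded').inv₀ hg.deriv_inversionConj_ne_zero).add
    ((tendsto_inv₀_cobounded (α := ℂ)).const_mul (g 0))
  rw [mul_zero, add_zero] at hslope
  refine hslope.congr fun z => ?_
  simp only [Function.comp_apply, zero_add, inversionConj_zero, sub_zero, smul_eq_mul, mul_inv,
    inversionConj_inv, inv_inv]
  ring

/-- The Koebe theorem for `inversionConj g`, whose image of the disc `‖ζ‖ < 1 / R` omits the values
at the other points. -/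
theorem norm_sub_le (hg : ConformalOutside R g) {z : ℂ} (hz : ‖z‖ ≤ R) :
    ‖g z - g 0‖ ≤ 24 * ‖derivInfty g‖ * R := by
  have hR := hg.radius_pos
  rcases eq_or_ne z 0 with rfl | hz0
  · rw [sub_self, norm_zero]
    positivity
  have hinj := inversionConj_injective hg.injective
  have homit : inversionConj g z⁻¹ ∉ inversionConj g '' Metric.ball 0 R⁻¹ := by
    rw [hinj.mem_set_image, mem_ball_zero_iff, norm_inv, not_lt]
    exact inv_anti₀ (norm_pos_iff.2 hz0) hz
  have hkoebe := mt (fun h => ball_subset_image_of_injOn hg.differentiableOn_inversionConj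
    hinj.injOn h) homit
  rw [inversionConj_zero, mem_ball_zero_iff, not_lt] at hkoebe
  have hpos : 0 < ‖deriv (inversionConj g) 0‖ := norm_pos_iff.2 hg.deriv_inversionConj_ne_zero
  calc ‖g z - g 0‖ = ‖inversionConj g z⁻¹‖⁻¹ := by rw [← norm_inv, inversionConj_inv]
    _ ≤ (‖deriv (inversionConj g) 0‖ * R⁻¹ / 24)⁻¹ := inv_anti₀ (by positivity) hkoebe
    _ = 24 * ‖derivInfty g‖ * R := by
      rw [derivInfty, norm_inv]
      field_simp

theorem differentiableOn_inv_dslope (hg : ConformalOutside R g) :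
    DifferentiableOn ℂ (fun ζ => (dslope (inversionConj g) 0 ζ)⁻¹) (Metric.ball 0 R⁻¹) := by
  refine DifferentiableOn.fun_inv ((Complex.differentiableOn_dslope (Metric.ball_mem_nhds 0
    (inv_pos.2 hg.radius_pos))).2 hg.differentiableOn_inversionConj) fun ζ _ h => ?_
  rcases eq_or_ne ζ 0 with rfl | hζ
  · exact hg.deriv_inversionConj_ne_zero (by rwa [dslope_same] at h)
  · have hzero := inv_dslope_inversionConj g hζ
    rw [h, inv_zero, zero_eq_mul, or_iff_right hζ, sub_eq_zero] at hzero
    exact inv_ne_zero hζ (hg.injective hzero)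

theorem norm_inv_dslope_le (hg : ConformalOutside R g) {ζ : ℂ} (hζ : ζ ∈ Metric.ball 0 R⁻¹) :
    ‖(dslope (inversionConj g) 0 ζ)⁻¹‖ ≤ 24 * ‖derivInfty g‖ := by
  rcases eq_or_ne ζ 0 with rfl | hζ0
  · rw [dslope_same, ← derivInfty]
    linarith [norm_nonneg (derivInfty g)]
  have hle : R ≤ ‖ζ⁻¹‖ := by
    rw [norm_inv]
    exact ((lt_inv_comm₀ (norm_pos_iff.2 hζ0) hg.radius_pos).1 (mem_ball_zero_iff.1 hζ)).le
  have hgrowth := (hg.mono hle).norm_sub_le le_rfl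
  rwa [norm_inv, ← div_eq_mul_inv, le_div_iff₀ (norm_pos_iff.2 hζ0), mul_comm, ← norm_mul,
    ← inv_dslope_inversionConj g hζ0] at hgrowth

/-- The Schwarz lemma for `ζ ↦ ζ (g (1 / ζ) - g 0)`, whose value at `ζ = 0` is `derivInfty g`. -/
theorem norm_div_sub_derivInfty_le (hg : ConformalOutside R g) {z : ℂ} (hz : R < ‖z‖) :
    ‖(g z - g 0) / z - derivInfty g‖ ≤ 25 * R * ‖derivInfty g‖ / ‖z‖ := by
  have hmaps : Set.MapsTo (fun ζ => (dslope (inversionConj g) 0 ζ)⁻¹) (Metric.ball 0 R⁻¹)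
      (Metric.closedBall (dslope (inversionConj g) 0 0)⁻¹ (25 * ‖derivInfty g‖)) := by
    intro ζ hζ
    rw [mem_closedBall_iff_norm, dslope_same, ← derivInfty]
    linarith [_root_.norm_sub_le (dslope (inversionConj g) 0 ζ)⁻¹ (derivInfty g),
      hg.norm_inv_dslope_le hζ]
  have hzmem : z⁻¹ ∈ Metric.ball (0 : ℂ) R⁻¹ := by
    rw [mem_ball_zero_iff, norm_inv]
    exact inv_strictAnti₀ hg.radius_pos hz
  have hz0 : z ≠ 0 := norm_pos_iff.1 (hg.radius_pos.trans hz)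
  have hschwarz := Complex.dist_le_div_mul_dist_of_mapsTo_ball hg.differentiableOn_inv_dslope
    hmaps hzmem
  rw [dslope_same, ← derivInfty, inv_dslope_inversionConj g (inv_ne_zero hz0), inv_inv,
    dist_eq_norm, dist_zero_right, norm_inv, div_inv_eq_mul, inv_mul_eq_div] at hschwarz
  exact hschwarz.trans_eq (by ring)

end ConformalOutside

section Motion

variable {F : ℂ → ℂ → ℂ} {U : Set ℂ} {R S : ℝ}

theorem ConformalOutside.norm_derivInfty_le {g : ℂ → ℂ} (hg : ConformalOutside R g) {z : ℂ}
    (hz : 50 * R ≤ ‖z‖) : ‖derivInfty g‖ ≤ 2 * ‖(g z - g 0) / z‖ := by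
  have hR := hg.radius_pos
  have hzR : R < ‖z‖ := by linarith
  have herror : 25 * R * ‖derivInfty g‖ / ‖z‖ ≤ ‖derivInfty g‖ / 2 := by
    rw [div_le_iff₀ (hR.trans hzR)]
    nlinarith [norm_nonneg (derivInfty g)]
  linarith [hg.norm_div_sub_derivInfty_le hzR,
    norm_sub_norm_le (derivInfty g) ((g z - g 0) / z),
    norm_sub_rev ((g z - g 0) / z) (derivInfty g)]

theorem tendstoLocallyUniformlyOn_derivInfty (hF : ∀ l ∈ U, ConformalOutside R (F l))
    (hcont : ∀ z, ContinuousOn (fun l => F l z) U) :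
    TendstoLocallyUniformlyOn (fun z l => (F l z - F l 0) / z) (fun l => derivInfty (F l))
      (cobounded ℂ) U := by
  rw [Metric.tendstoLocallyUniformlyOn_iff]
  intro ε hε l hl
  have hR := (hF l hl).radius_pos
  obtain ⟨p, hp⟩ := NormedSpace.exists_lt_norm ℂ ℂ (50 * R)
  have hquot : ContinuousOn (fun l' => 2 * ‖(F l' p - F l' 0) / p‖) U :=
    ((((hcont p).sub (hcont 0)).div_const p).norm).const_mul 2
  obtain ⟨A, hA⟩ : ∃ A, 2 * ‖(F l p - F l 0) / p‖ < A := exists_gt _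
  refine ⟨{l' ∈ U | 2 * ‖(F l' p - F l' 0) / p‖ < A},
    (eventually_mem_nhdsWithin).and ((hquot l hl).eventually (gt_mem_nhds hA)), ?_⟩
  filter_upwards [tendsto_norm_cobounded_atTop.eventually_gt_atTop (max R (25 * R * A / ε))]
    with z hz l' ⟨hl', hlA⟩
  obtain ⟨hzR, hzA⟩ := max_lt_iff.1 hz
  rw [div_lt_comm₀ hε (hR.trans hzR)] at hzA
  rw [dist_comm, dist_eq_norm]
  calc _ ≤ 25 * R * ‖derivInfty (F l')‖ / ‖z‖ := (hF l' hl').norm_div_sub_derivInfty_le hzR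
    _ ≤ 25 * R * A / ‖z‖ := by
      gcongr
      exact ((hF l' hl').norm_derivInfty_le hp.le).trans hlA.le
    _ < ε := hzA

theorem differentiableOn_derivInfty (hU : IsOpen U) (hF : ∀ l ∈ U, ConformalOutside R (F l))
    (hdiff : ∀ z, DifferentiableOn ℂ (fun l => F l z) U) :
    DifferentiableOn ℂ (fun l => derivInfty (F l)) U :=
  (tendstoLocallyUniformlyOn_derivInfty hF fun z => (hdiff z).continuousOn).differentiableOn
    (.of_forall fun z => ((hdiff z).sub (hdiff 0)).div_const z) hU

/-- Harnack's inequality for `l ↦ (F l w - F l z) / derivInfty (F l)`, which equals `w - z` at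
`l = 0` and is bounded by `48 S` according to `ConformalOutside.norm_sub_le`. -/
theorem norm_sub_le_rpow_of_motion (hF : ∀ l ∈ Metric.ball (0 : ℂ) 1, ConformalOutside S (F l))
    (hdiff : ∀ z, DifferentiableOn ℂ (fun l => F l z) (Metric.ball 0 1))
    (hzero : ∀ z, F 0 z = z) {l w z : ℂ} (hl : l ∈ Metric.ball (0 : ℂ) 1)
    (hw : ‖w‖ ≤ S) (hz : ‖z‖ ≤ S) (hwz : w ≠ z) :
    ‖F l w - F l z‖ ≤
      ‖derivInfty (F l)‖ * (48 * S * (‖w - z‖ / (48 * S)) ^ ((1 - ‖l‖) / (1 + ‖l‖))) := by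
  have hzero' : F 0 = id := funext hzero
  have hbound : ∀ l ∈ Metric.ball (0 : ℂ) 1,
      ‖(F l w - F l z) / derivInfty (F l)‖ ≤ 48 * S := fun l hl => by
    rw [norm_div, div_le_iff₀ (norm_pos_iff.2 (hF l hl).derivInfty_ne_zero)]
    linarith [(hF l hl).norm_sub_le hw, (hF l hl).norm_sub_le hz,
      norm_sub_le_norm_sub_add_norm_sub (F l w) (F l 0) (F l z),
      norm_sub_rev (F l 0) (F l z)]
  have hharnack := norm_le_mul_rpow_of_norm_le
    (((hdiff w).fun_sub (hdiff z)).fun_div (differentiableOn_derivInfty Metric.isOpen_ball hF hdiff)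
      fun l hl => (hF l hl).derivInfty_ne_zero)
    (fun l hl => div_ne_zero (sub_ne_zero.2 ((hF l hl).injective.ne hwz))
      (hF l hl).derivInfty_ne_zero) hbound hl
  rwa [hzero', derivInfty_id, id, id, div_one, norm_div,
    div_le_iff₀' (norm_pos_iff.2 (hF l hl).derivInfty_ne_zero)] at hharnack

theorem continuous_of_motion (hF : ∀ l ∈ Metric.ball (0 : ℂ) 1, ConformalOutside R (F l))
    (hdiff : ∀ z, DifferentiableOn ℂ (fun l => F l z) (Metric.ball 0 1))
    (hzero : ∀ z, F 0 z = z) {l : ℂ} (hl : l ∈ Metric.ball (0 : ℂ) 1) : Continuous (F l) := by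
  refine continuous_iff_continuousAt.2 fun z => ?_
  set S := max R (‖z‖ + 1)
  have hexponent : 0 < (1 - ‖l‖) / (1 + ‖l‖) :=
    div_pos (sub_pos.2 (mem_ball_zero_iff.1 hl)) (by positivity)
  have hlimit : Tendsto (fun w => ‖derivInfty (F l)‖ *
      (48 * S * (‖w - z‖ / (48 * S)) ^ ((1 - ‖l‖) / (1 + ‖l‖)))) (𝓝 z) (𝓝 0) := by
    have hcont : ContinuousAt (fun w => ‖derivInfty (F l)‖ *
        (48 * S * (‖w - z‖ / (48 * S)) ^ ((1 - ‖l‖) / (1 + ‖l‖)))) z := by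
      fun_prop (disch := exact Or.inr hexponent.le)
    simpa [ContinuousAt, Real.zero_rpow hexponent.ne'] using hcont
  rw [continuousAt_iff_punctured_nhds, tendsto_iff_norm_sub_tendsto_zero]
  refine squeeze_zero' (.of_forall fun w => norm_nonneg _) ?_ (hlimit.mono_left nhdsWithin_le_nhds)
  filter_upwards [eventually_mem_nhdsWithin,
    mem_nhdsWithin_of_mem_nhds (Metric.ball_mem_nhds z one_pos)] with w hwz hw
  have hwS : ‖w‖ ≤ S := le_max_of_le_right
    (by linarith [norm_le_norm_add_norm_sub' w z, mem_ball_iff_norm.1 hw])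
  exact norm_sub_le_rpow_of_motion (fun l hl => (hF l hl).mono (le_max_left _ _)) hdiff hzero hl hwS
    (le_max_of_le_right (by linarith)) hwz

end Motion

section Homeomorphism

variable {g : ℂ → ℂ} {a : ℂ}

theorem not_exists_continuousOn_log_sphere {ρ : ℝ} (hρ : 0 < ρ) :
    ¬∃ L : ℂ → ℂ, ContinuousOn L (Metric.sphere 0 ρ) ∧
      ∀ z ∈ Metric.sphere (0 : ℂ) ρ, Complex.exp (L z) = z := by
  rintro ⟨L, hL, hexp⟩
  have hmem : ∀ t, circleMap 0 ρ t ∈ Metric.sphere (0 : ℂ) ρ := circleMap_mem_sphere 0 hρ.le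
  have hlifts : (fun t => L (circleMap 0 ρ t)) = fun t : ℝ => L ρ + t * Complex.I := by
    refine Complex.isCoveringMap_exp.eq_of_comp_eq
      (hL.comp_continuous (continuous_circleMap 0 ρ) hmem) (by fun_prop) ?_ 0 (by simp [circleMap])
    ext t
    have hLρ := hexp ρ (by simpa [circleMap] using hmem 0)
    simp only [Function.comp_apply, Complex.exp_add, hLρ]
    rw [hexp _ (hmem t), circleMap, zero_add]
  have hperiod := congrFun hlifts (2 * Real.pi)
  simp [circleMap] at hperiod

theorem tendsto_cobounded_of_tendsto_div (ha : a ≠ 0)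
    (hlim : Tendsto (fun z => g z / z) (cobounded ℂ) (𝓝 a)) :
    Tendsto g (cobounded ℂ) (cobounded ℂ) := by
  rw [← tendsto_norm_atTop_iff_cobounded]
  refine (tendsto_norm_cobounded_atTop.atTop_mul_pos (norm_pos_iff.2 ha) hlim.norm).congr' ?_
  filter_upwards [eventually_ne_cobounded 0] with z hz
  rw [← norm_mul, mul_div_cancel₀ _ hz]

/-- If `g` omitted `w`, then `log (g z - w) - log ((g z - w) / (a z)) - log a` would be a continuous
logarithm of `z` on large circles. -/
theorem surjective_of_tendsto_div (hg : Continuous g) (ha : a ≠ 0)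
    (hlim : Tendsto (fun z => g z / z) (cobounded ℂ) (𝓝 a)) : Function.Surjective g := by
  intro w
  by_contra! hw
  have hgw : ∀ z, g z - w ≠ 0 := fun z => sub_ne_zero.2 (hw z)
  obtain ⟨L, hL, hexp⟩ := Complex.exists_continuousOn_eqOn_exp_comp
    (isSimplyConnected_of_convex convex_univ Set.univ_nonempty) isOpen_univ
    (hg.sub continuous_const).continuousOn fun ⟨z, _, h⟩ => hgw z h
  have hratio : Tendsto (fun z => (g z - w) / (a * z)) (cobounded ℂ) (𝓝 1) := by
    have hquot := (hlim.sub (tendsto_inv₀_cobounded.const_mul w)).div_const a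
    rw [mul_zero, sub_zero, div_self ha] at hquot
    refine hquot.congr fun z => ?_
    rw [← div_eq_mul_inv, ← sub_div, div_div, mul_comm z]
  obtain ⟨r, -, hr⟩ := (hasBasis_cobounded_norm (E := ℂ)).eventually_iff.1
    (hratio.eventually (Complex.isOpen_slitPlane.mem_nhds Complex.one_mem_slitPlane))
  have hρ : 0 < max r 1 := lt_max_of_lt_right one_pos
  have hslit : ∀ z ∈ Metric.sphere (0 : ℂ) (max r 1), (g z - w) / (a * z) ∈ Complex.slitPlane :=
    fun z hz => hr ((le_max_left r 1).trans_eq (mem_sphere_zero_iff_norm.1 hz).symm)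
  have hz0 : ∀ z ∈ Metric.sphere (0 : ℂ) (max r 1), z ≠ 0 :=
    fun z hz => norm_pos_iff.1 (hρ.trans_eq (mem_sphere_zero_iff_norm.1 hz).symm)
  refine not_exists_continuousOn_log_sphere hρ
    ⟨fun z => L z - Complex.log ((g z - w) / (a * z)) - Complex.log a, ?_, fun z hz => ?_⟩
  · have hratio_cont : ContinuousOn (fun z => (g z - w) / (a * z)) (Metric.sphere 0 (max r 1)) :=
      ContinuousOn.div (by fun_prop) (by fun_prop) fun z hz => mul_ne_zero ha (hz0 z hz)
    exact ((hL.mono (Set.subset_univ _)).sub (hratio_cont.clog hslit)).sub continuousOn_const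
  · have hLz : Complex.exp (L z) = g z - w := hexp (Set.mem_univ z)
    rw [Complex.exp_sub, Complex.exp_sub, hLz,
      Complex.exp_log (Complex.slitPlane_ne_zero (hslit z hz)), Complex.exp_log ha,
      div_div_cancel₀ (hgw z), mul_div_cancel_left₀ z ha]

theorem isHomeomorph_of_tendsto_div (hg : Continuous g) (hinj : Function.Injective g) (ha : a ≠ 0)
    (hlim : Tendsto (fun z => g z / z) (cobounded ℂ) (𝓝 a)) : IsHomeomorph g := by
  have hproper : IsProperMap g := by
    rw [isProperMap_iff_tendsto_cocompact, ← Metric.cobounded_eq_cocompact]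
    exact ⟨hg, tendsto_cobounded_of_tendsto_div ha hlim⟩
  exact isHomeomorph_iff_continuous_isClosedMap_bijective.2
    ⟨hg, hproper.isClosedMap, hinj, surjective_of_tendsto_div hg ha hlim⟩

end Homeomorphism

namespace RiemannSphere

instance : IsManifold 𝓘(ℂ) 1 RiemannSphere :=
  IsManifold.of_le (n := ω) le_top

theorem mdifferentiableAt_chartFinite (z : ℂ) :
    MDifferentiableAt 𝓘(ℂ) 𝓘(ℂ) chartFinite (z : RiemannSphere) :=
  mdifferentiableAt_atlas (Or.inl rfl) (OnePoint.coe_ne_infty z)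

theorem mdifferentiableAt_coe (z : ℂ) :
    MDifferentiableAt 𝓘(ℂ) 𝓘(ℂ) (fun z : ℂ => (z : RiemannSphere)) z :=
  mdifferentiableAt_atlas_symm (e := chartFinite) (Or.inl rfl) (Set.mem_univ z)

theorem mdifferentiableAt_chartInfty :
    MDifferentiableAt 𝓘(ℂ) 𝓘(ℂ) chartInfty (OnePoint.infty : RiemannSphere) :=
  mdifferentiableAt_atlas (Or.inr rfl) (OnePoint.infty_ne_coe 0)

theorem tendsto_coe_cobounded :
    Tendsto (fun z : ℂ => (z : RiemannSphere)) (cobounded ℂ) (𝓝 OnePoint.infty) := by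
  rw [Metric.cobounded_eq_cocompact, ← coclosedCompact_eq_cocompact]
  exact OnePoint.tendsto_coe_infty

theorem comap_coe_nhds_infty :
    comap (fun z : ℂ => (z : RiemannSphere)) (𝓝 OnePoint.infty) = cobounded ℂ := by
  rw [OnePoint.comap_coe_nhds_infty, coclosedCompact_eq_cocompact, Metric.cobounded_eq_cocompact]

theorem coe_mem_sphereCompl {K : Set ℂ} {z : ℂ} :
    (z : RiemannSphere) ∈ sphereCompl K ↔ z ∈ Kᶜ := by
  simp [sphereCompl]

theorem infty_mem_sphereCompl (K : Set ℂ) : (OnePoint.infty : RiemannSphere) ∈ sphereCompl K := by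
  simp [sphereCompl]

theorem isOpen_sphereCompl {K : Set ℂ} (hK : IsCompact K) : IsOpen (sphereCompl K) :=
  (hK.image OnePoint.continuous_coe).isClosed.isOpen_compl

theorem differentiableOn_comp_coe {K : Set ℂ} {g : RiemannSphere → ℂ}
    (hg : MDifferentiableOn 𝓘(ℂ) 𝓘(ℂ) g (sphereCompl K)) :
    DifferentiableOn ℂ (fun z : ℂ => g z) Kᶜ :=
  mdifferentiableOn_iff_differentiableOn.1 <|
    hg.comp (fun z _ => (mdifferentiableAt_coe z).mdifferentiableWithinAt)
      fun _ => coe_mem_sphereCompl.2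

/-- The removable singularity theorem at `∞`. -/
theorem mdifferentiableOn_elim {K : Set ℂ} (hK : IsCompact K) {g : ℂ → ℂ} {c : ℂ}
    (hg : DifferentiableOn ℂ g Kᶜ) (hc : Tendsto g (cobounded ℂ) (𝓝 c)) :
    MDifferentiableOn 𝓘(ℂ) 𝓘(ℂ) (fun p : RiemannSphere => p.elim c g) (sphereCompl K) := by
  intro p hp
  have hdiff : ∀ z ∉ K, DifferentiableAt ℂ g z := fun z hz =>
    hg.differentiableAt (hK.isClosed.isOpen_compl.mem_nhds hz)
  refine MDifferentiableAt.mdifferentiableWithinAt ?_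
  induction p using OnePoint.rec with
  | infty =>
    let h : ℂ → ℂ := Function.update (fun ζ => g ζ⁻¹) 0 c
    have hcont : ContinuousAt h 0 :=
      continuousAt_update_same.2 (hc.comp (tendsto_inv₀_nhdsNE_zero (α := ℂ)))
    have hpunctured : ∀ᶠ ζ in 𝓝[≠] 0, DifferentiableAt ℂ h ζ := by
      filter_upwards [tendsto_inv₀_nhdsNE_zero.eventually hK.isBounded, self_mem_nhdsWithin]
        with ζ hζK hζ
      refine ((hdiff ζ⁻¹ hζK).comp ζ (differentiableAt_inv hζ)).congr_of_eventuallyEq ?_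
      filter_upwards [isOpen_ne.mem_nhds hζ] with η hη
      exact Function.update_of_ne hη _ _
    have hh0 : MDifferentiableAt 𝓘(ℂ) 𝓘(ℂ) h (chartInfty OnePoint.infty) :=
      (Complex.analyticAt_of_differentiable_on_punctured_nhds_of_continuousAt hpunctured
        hcont).differentiableAt.mdifferentiableAt
    refine (hh0.comp _ mdifferentiableAt_chartInfty).congr_of_eventuallyEq ?_
    filter_upwards [chartInfty.open_source.mem_nhds (OnePoint.infty_ne_coe 0)] with q hq
    induction q using OnePoint.rec with
    | infty => exact (Function.update_self (0 : ℂ) c fun ζ => g ζ⁻¹).symm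
    | coe z =>
      have hz : z⁻¹ ≠ 0 := inv_ne_zero fun hz => hq (by simp [hz])
      change g z = h z⁻¹
      simp only [h, Function.update_of_ne hz, inv_inv]
  | coe z =>
    refine ((hdiff z (coe_mem_sphereCompl.1 hp)).mdifferentiableAt.comp (z : RiemannSphere)
      (mdifferentiableAt_chartFinite z)).congr_of_eventuallyEq ?_
    filter_upwards [chartFinite.open_source.mem_nhds (OnePoint.coe_ne_infty z)] with q hq
    induction q using OnePoint.rec with
    | infty => exact absurd rfl hq
    | coe w => rfl

end RiemannSphere

/-- The set of the numbers `|g'(∞)|` for the holomorphic `g : (ℂ ∪ {∞}) ∖ K → 𝔻`, described on the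
finite plane: `c` is the value of `g` at `∞` and `d` is `g'(∞)`. -/
def derivInftyNorms (K : Set ℂ) : Set ℝ :=
  {r : ℝ | ∃ (g : ℂ → ℂ) (c d : ℂ), DifferentiableOn ℂ g Kᶜ ∧ (∀ z ∈ Kᶜ, ‖g z‖ < 1) ∧ ‖c‖ < 1 ∧
    Tendsto (fun z => z * (g z - c)) (cobounded ℂ) (𝓝 d) ∧ r = ‖d‖}

section AnalyticCapacity

variable {K K' : Set ℂ}

theorem tendsto_of_tendsto_mul_sub {g : ℂ → ℂ} {c d : ℂ}
    (hd : Tendsto (fun z => z * (g z - c)) (cobounded ℂ) (𝓝 d)) :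
    Tendsto g (cobounded ℂ) (𝓝 c) := by
  have hprod := (tendsto_inv₀_cobounded.mul hd).add_const c
  rw [zero_mul, zero_add] at hprod
  refine hprod.congr' ?_
  filter_upwards [eventually_ne_cobounded 0] with z hz
  rw [inv_mul_cancel_left₀ hz, sub_add_cancel]

theorem analyticCapacity_eq_sSup (hK : IsCompact K) :
    analyticCapacity K = sSup (derivInftyNorms K) := by
  refine congrArg sSup (Set.ext fun r => ⟨?_, ?_⟩)
  · rintro ⟨g, d, hg, hg1, hd, rfl⟩
    exact ⟨fun z => g z, g OnePoint.infty, d, RiemannSphere.differentiableOn_comp_coe hg,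
      fun z hz => hg1 z (RiemannSphere.coe_mem_sphereCompl.2 hz),
      hg1 _ (RiemannSphere.infty_mem_sphereCompl K), hd, rfl⟩
  · rintro ⟨g, c, d, hg, hg1, hc, hd, rfl⟩
    refine ⟨fun p => p.elim c g, d,
      RiemannSphere.mdifferentiableOn_elim hK hg (tendsto_of_tendsto_mul_sub hd), ?_, hd, rfl⟩
    intro p hp
    induction p using OnePoint.rec with
    | infty => exact hc
    | coe z => exact hg1 z (RiemannSphere.coe_mem_sphereCompl.1 hp)

open scoped Pointwise in
theorem derivInftyNorms_subset_smul {φ : ℂ → ℂ} {a : ℂ} (hφ : DifferentiableOn ℂ φ Kᶜ)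
    (hmaps : Set.MapsTo φ Kᶜ K'ᶜ) (ha : a ≠ 0)
    (hlim : Tendsto (fun z => φ z / z) (cobounded ℂ) (𝓝 a)) :
    derivInftyNorms K' ⊆ ‖a‖ • derivInftyNorms K := by
  rintro _ ⟨g, c, d, hg, hg1, hc, hd, rfl⟩
  have hφ_cobounded := tendsto_cobounded_of_tendsto_div ha hlim
  refine ⟨‖d * a⁻¹‖, ⟨g ∘ φ, c, d * a⁻¹, hg.comp hφ hmaps, fun z hz => hg1 _ (hmaps hz), hc, ?_,
    rfl⟩, ?_⟩
  · refine ((hd.comp hφ_cobounded).mul (hlim.inv₀ ha)).congr' ?_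
    filter_upwards [hφ_cobounded.eventually (eventually_ne_cobounded 0)] with z hφz
    simp only [Function.comp_apply, inv_div]
    field_simp
  · simp only [smul_eq_mul]
    rw [← norm_mul, mul_comm, inv_mul_cancel_right₀ ha]

theorem tendsto_symm_div (e : ℂ ≃ₜ ℂ) {a : ℂ} (ha : a ≠ 0)
    (hlim : Tendsto (fun z => e z / z) (cobounded ℂ) (𝓝 a)) :
    Tendsto (fun w => e.symm w / w) (cobounded ℂ) (𝓝 a⁻¹) := by
  have hsymm : Tendsto e.symm (cobounded ℂ) (cobounded ℂ) := by
    rw [Metric.cobounded_eq_cocompact]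
    exact e.symm.isClosedEmbedding.tendsto_cocompact
  refine ((hlim.comp hsymm).inv₀ ha).congr fun w => ?_
  simp only [Function.comp_apply, e.apply_symm_apply, inv_div]

open scoped Pointwise in
theorem analyticCapacity_image (hK : IsCompact K) (e : ℂ ≃ₜ ℂ) (he : DifferentiableOn ℂ e Kᶜ)
    {a : ℂ} (ha : a ≠ 0) (hlim : Tendsto (fun z => e z / z) (cobounded ℂ) (𝓝 a)) :
    analyticCapacity (e '' K) = ‖a‖ * analyticCapacity K := by
  have hcompl : e '' Kᶜ = (e '' K)ᶜ := Set.image_compl_eq e.bijective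
  have hsymm : DifferentiableOn ℂ e.symm (e '' K)ᶜ := by
    rw [← hcompl]
    rintro _ ⟨z, hz, rfl⟩
    exact (differentiableAt_of_leftInvOn he hK.isClosed.isOpen_compl
      (fun z _ => e.symm_apply_apply z) hz).differentiableWithinAt
  have hmaps : Set.MapsTo e Kᶜ (e '' K)ᶜ := Set.mapsTo_iff_image_subset.2 hcompl.subset
  have hmaps_symm : Set.MapsTo e.symm (e '' K)ᶜ Kᶜ := by
    rw [← hcompl]
    rintro _ ⟨z, hz, rfl⟩
    rwa [e.symm_apply_apply]
  have hsmul : derivInftyNorms (e '' K) = ‖a‖ • derivInftyNorms K := by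
    refine (derivInftyNorms_subset_smul he hmaps ha hlim).antisymm ?_
    rw [Set.smul_set_subset_iff₀ (norm_ne_zero_iff.2 ha), ← norm_inv]
    exact derivInftyNorms_subset_smul hsymm hmaps_symm (inv_ne_zero ha) (tendsto_symm_div e ha hlim)
  rw [analyticCapacity_eq_sSup hK, analyticCapacity_eq_sSup (hK.image e.continuous), hsmul,
    Real.sSup_smul_of_nonneg (norm_nonneg a), smul_eq_mul]

end AnalyticCapacity

/-- The restriction to `ℂ` of a self-map of the sphere, as a map to `ℂ`. Its value is the junk
value `0` at the points that are sent to `∞`. -/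
noncomputable def RiemannSphere.finitePart (Φ : RiemannSphere → RiemannSphere) (z : ℂ) : ℂ :=
  chartFinite (Φ z)

namespace RiemannSphere

variable {Φ : RiemannSphere → RiemannSphere} {K : Set ℂ}

theorem coe_finitePart (hinj : Function.Injective Φ) (hinf : Φ OnePoint.infty = OnePoint.infty)
    (z : ℂ) : (finitePart Φ z : RiemannSphere) = Φ z :=
  chartFinite.left_inv (hinf ▸ hinj.ne (OnePoint.coe_ne_infty z) : Φ z ≠ OnePoint.infty)

theorem finitePart_injective (hinj : Function.Injective Φ)
    (hinf : Φ OnePoint.infty = OnePoint.infty) : Function.Injective (finitePart Φ) := by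
  intro z w hzw
  rw [← OnePoint.coe_eq_coe, coe_finitePart hinj hinf, coe_finitePart hinj hinf] at hzw
  exact OnePoint.coe_injective (hinj hzw)

theorem differentiableOn_finitePart (hinj : Function.Injective Φ)
    (hinf : Φ OnePoint.infty = OnePoint.infty)
    (hΦ : MDifferentiableOn 𝓘(ℂ) 𝓘(ℂ) Φ (sphereCompl K)) :
    DifferentiableOn ℂ (finitePart Φ) Kᶜ := by
  refine mdifferentiableOn_iff_differentiableOn.1 fun z hz => ?_
  have hchart := mdifferentiableAt_chartFinite (finitePart Φ z)
  rw [coe_finitePart hinj hinf] at hchart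
  exact hchart.comp_mdifferentiableWithinAt z
    ((hΦ z (coe_mem_sphereCompl.2 hz)).comp z (mdifferentiableAt_coe z).mdifferentiableWithinAt
      fun _ => coe_mem_sphereCompl.2)

theorem tendsto_finitePart (hinj : Function.Injective Φ)
    (hinf : Φ OnePoint.infty = OnePoint.infty) (hcont : ContinuousAt Φ OnePoint.infty) :
    Tendsto (finitePart Φ) (cobounded ℂ) (cobounded ℂ) := by
  have hlim := hcont.tendsto.comp tendsto_coe_cobounded
  rw [hinf] at hlim
  nth_rw 2 [← comap_coe_nhds_infty]
  exact tendsto_comap_iff.2 (hlim.congr fun z => (coe_finitePart hinj hinf z).symm)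

theorem conformalOutside_finitePart (hK : IsCompact K) {R : ℝ} (hR : 0 < R)
    (hKR : K ⊆ Metric.closedBall 0 R) (hinj : Function.Injective Φ)
    (hinf : Φ OnePoint.infty = OnePoint.infty)
    (hΦ : MDifferentiableOn 𝓘(ℂ) 𝓘(ℂ) Φ (sphereCompl K)) :
    ConformalOutside R (finitePart Φ) where
  radius_pos := hR
  injective := finitePart_injective hinj hinf
  differentiableOn :=
    (differentiableOn_finitePart hinj hinf hΦ).mono (Set.compl_subset_compl.2 hKR)
  tendsto_cobounded := tendsto_finitePart hinj hinf (hΦ.mdifferentiableAt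
    ((isOpen_sphereCompl hK).mem_nhds (infty_mem_sphereCompl K))).continuousAt

end RiemannSphere

section HolomorphicMotion

open RiemannSphere

variable {K : Set ℂ} {f : ℂ → RiemannSphere → RiemannSphere} {l : ℂ}

theorem IsHolomorphicMotion.injective (hf : IsHolomorphicMotion Set.univ f)
    (hl : l ∈ Metric.ball 0 1) : Function.Injective (f l) :=
  Set.injOn_univ.1 (hf.injOn l hl)

theorem IsHolomorphicMotion.differentiableOn_finitePart (hf : IsHolomorphicMotion Set.univ f)
    (hinf : ∀ l ∈ Metric.ball (0 : ℂ) 1, f l OnePoint.infty = OnePoint.infty) (z : ℂ) :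
    DifferentiableOn ℂ (fun l => finitePart (f l) z) (Metric.ball 0 1) := by
  refine mdifferentiableOn_iff_differentiableOn.1 fun l hl => ?_
  have hchart := mdifferentiableAt_chartFinite (finitePart (f l) z)
  rw [coe_finitePart (hf.injective hl) (hinf l hl)] at hchart
  exact hchart.comp_mdifferentiableWithinAt l (hf.holomorphic z (Set.mem_univ _) l hl)

theorem IsHolomorphicMotion.finitePart_zero (hf : IsHolomorphicMotion Set.univ f) (z : ℂ) :
    finitePart (f 0) z = z := by
  rw [finitePart, hf.map_zero z (Set.mem_univ _)]
  rfl

theorem movedSet_eq_image (hinj : Function.Injective (f l))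
    (hinf : f l OnePoint.infty = OnePoint.infty) : movedSet f K l = finitePart (f l) '' K := by
  ext w
  simp only [movedSet, Set.mem_image, Set.mem_ofPred_eq, ← coe_finitePart hinj hinf,
    OnePoint.coe_eq_coe]

theorem IsHolomorphicMotion.movedSet_zero (hf : IsHolomorphicMotion Set.univ f) :
    movedSet f K 0 = K := by
  have h0 := Metric.mem_ball_self (x := (0 : ℂ)) one_pos
  rw [movedSet_eq_image (hf.injective h0) (hf.map_zero _ (Set.mem_univ _)),
    funext hf.finitePart_zero, Set.image_id']

variable (hK : IsCompact K) (hf : IsHolomorphicMotion Set.univ f)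
  (hhol : ∀ l ∈ Metric.ball (0 : ℂ) 1, MDifferentiableOn 𝓘(ℂ) 𝓘(ℂ) (f l) (sphereCompl K))
  (hinf : ∀ l ∈ Metric.ball (0 : ℂ) 1, f l OnePoint.infty = OnePoint.infty)
include hK hf hhol hinf

theorem exists_conformalOutside_finitePart :
    ∃ R, ∀ l ∈ Metric.ball (0 : ℂ) 1, ConformalOutside R (finitePart (f l)) := by
  obtain ⟨R, hR, hKR⟩ := hK.isBounded.subset_closedBall_lt 0 0
  exact ⟨R, fun l hl =>
    conformalOutside_finitePart hK hR hKR (hf.injective hl) (hinf l hl) (hhol l hl)⟩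

theorem isHomeomorph_finitePart (hl : l ∈ Metric.ball 0 1) : IsHomeomorph (finitePart (f l)) := by
  obtain ⟨R, hR⟩ := exists_conformalOutside_finitePart hK hf hhol hinf
  exact isHomeomorph_of_tendsto_div
    (continuous_of_motion hR (hf.differentiableOn_finitePart hinf) hf.finitePart_zero hl)
    (hR l hl).injective (hR l hl).derivInfty_ne_zero (hR l hl).tendsto_div

theorem isCompact_movedSet (hl : l ∈ Metric.ball 0 1) : IsCompact (movedSet f K l) := by
  rw [movedSet_eq_image (hf.injective hl) (hinf l hl)]
  exact hK.image (isHomeomorph_finitePart hK hf hhol hinf hl).continuous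

theorem analyticCapacity_movedSet (hl : l ∈ Metric.ball 0 1) :
    analyticCapacity (movedSet f K l) = ‖derivInfty (finitePart (f l))‖ * analyticCapacity K := by
  obtain ⟨R, hR⟩ := exists_conformalOutside_finitePart hK hf hhol hinf
  rw [movedSet_eq_image (hf.injective hl) (hinf l hl)]
  exact analyticCapacity_image hK (isHomeomorph_finitePart hK hf hhol hinf hl).homeomorph
    (differentiableOn_finitePart (hf.injective hl) (hinf l hl) (hhol l hl))
    (hR l hl).derivInfty_ne_zero (hR l hl).tendsto_div

theorem exists_norm_eq_analyticCapacity_movedSet (hγ : 0 < analyticCapacity K) :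
    ∃ φ : ℂ → ℂ, DifferentiableOn ℂ φ (Metric.ball 0 1) ∧ (∀ l ∈ Metric.ball 0 1, φ l ≠ 0) ∧
      ∀ l ∈ Metric.ball 0 1, ‖φ l‖ = analyticCapacity (movedSet f K l) := by
  obtain ⟨R, hR⟩ := exists_conformalOutside_finitePart hK hf hhol hinf
  refine ⟨fun l => derivInfty (finitePart (f l)) * analyticCapacity K,
    (differentiableOn_derivInfty Metric.isOpen_ball hR
      (hf.differentiableOn_finitePart hinf)).mul_const _,
    fun l hl => mul_ne_zero (hR l hl).derivInfty_ne_zero (Complex.ofReal_ne_zero.2 hγ.ne'),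
    fun l hl => ?_⟩
  rw [norm_mul, Complex.norm_of_nonneg hγ.le, analyticCapacity_movedSet hK hf hhol hinf hl]

end HolomorphicMotion

theorem div_bounds_of_abs_sub_le {x y t : ℝ} (ht0 : 0 ≤ t) (ht1 : t < 1) (hy : 0 < y)
    (h : |x - y| ≤ t * (x + y)) : (1 - t) / (1 + t) ≤ x / y ∧ x / y ≤ (1 + t) / (1 - t) := by
  obtain ⟨hlower, hupper⟩ := abs_le.1 h
  rw [div_le_div_iff₀ (by linarith) hy, div_le_div_iff₀ hy (by linarith)]
  constructor <;> linarith

theorem eq_zero_of_abs_le_mul_self {x t : ℝ} (ht0 : 0 ≤ t) (ht1 : t < 1) (h : |x| ≤ t * x) :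
    x = 0 := by
  by_contra hx
  nlinarith [abs_pos.2 hx, le_abs_self x]

theorem mainTheorem2 (K : Set ℂ) (hK : IsCompact K) (hγ : 0 < analyticCapacity K)
    (f : ℂ → RiemannSphere → RiemannSphere)
    (hf : IsHolomorphicMotion Set.univ f)
    (hhol : ∀ lam ∈ Metric.ball (0 : ℂ) 1,
      MDifferentiableOn 𝓘(ℂ) 𝓘(ℂ) (f lam) (sphereCompl K))
    (hinf : ∀ lam ∈ Metric.ball (0 : ℂ) 1, f lam OnePoint.infty = OnePoint.infty)
    (M : ℝ)
    (hM : ∀ lam ∈ Metric.ball (0 : ℂ) 1, analyticCapacity (movedSet f K lam) ≤ M) :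
    ∀ lam ∈ Metric.ball (0 : ℂ) 1,
      IsCompact (movedSet f K lam) ∧
      0 < analyticCapacity (movedSet f K lam) ∧
      (analyticCapacity K < M →
        (1 - ‖lam‖) / (1 + ‖lam‖) ≤
            Real.log (M / analyticCapacity (movedSet f K lam)) /
              Real.log (M / analyticCapacity K) ∧
        Real.log (M / analyticCapacity (movedSet f K lam)) /
              Real.log (M / analyticCapacity K) ≤
            (1 + ‖lam‖) / (1 - ‖lam‖)) ∧
      (analyticCapacity K = M → analyticCapacity (movedSet f K lam) = M) := by
  intro l hl
  obtain ⟨φ, hφ, hφ0, hφ_norm⟩ := exists_norm_eq_analyticCapacity_movedSet hK hf hhol hinf hγ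
  have hl1 : ‖l‖ < 1 := mem_ball_zero_iff.1 hl
  have hpos : 0 < analyticCapacity (movedSet f K l) := hφ_norm l hl ▸ norm_pos_iff.2 (hφ0 l hl)
  have hharnack := harnack_log_div_norm hφ hφ0 (fun w hw => (hφ_norm w hw).trans_le (hM w hw)) hl
  rw [hφ_norm l hl, hφ_norm 0 (Metric.mem_ball_self one_pos), hf.movedSet_zero, dist_zero_right,
    div_one] at hharnack
  refine ⟨isCompact_movedSet hK hf hhol hinf hl, hpos, fun hlt => ?_, ?_⟩
  · exact div_bounds_of_abs_sub_le (norm_nonneg l) hl1 (Real.log_pos ((one_lt_div hγ).2 hlt))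
      hharnack
  · rintro rfl
    rw [div_self hγ.ne', Real.log_one, sub_zero, add_zero] at hharnack
    have hlog := eq_zero_of_abs_le_mul_self (norm_nonneg l) hl1 hharnack
    exact ((div_eq_one_iff_eq hpos.ne').1
      (Real.eq_one_of_pos_of_log_eq_zero (div_pos hγ hpos) hlog)).symm
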